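/- Let $d\ge 1$ be an integer and $s\in(0,1]$. For $\xi\in\mathbb{R}^d$ put $\omega(\xi)=4\sum_{j=1}^d\sin^2(\xi_j/2)$, and for $t>0$ and $x\in\mathbb{Z}^d$ define the lattice fractional heat kernel $$G_t^{(s)}(x)=\frac{1}{(2\pi)^d}\int_{[-\pi,\pi]^d}e^{-t\,\omega(\xi)^s}\,e^{i\langle x,\xi\rangle}\,d\xi,\qquad \langle x,\xi\rangle=\sum_{j=1}^d x_j\xi_j .$$ Write $|y|=(y_1^2+\cdots+y_d^2)^{1/2}$ for $y\in\mathbb{Z}^d$. Then there exists a constant $C=C(d,s)>0$ such that for all $t>0$ and all $y\in\mathbb{Z}^d$ the series below converges and $$\sum_{x\in\mathbb{Z}^d}\bigl|G_t^{(s)}(x-y)-G_t^{(s)}(x)\bigr|\le C\,\min\bigl\{1,\ |y|\,t^{-1/(2s)}\bigr\}.$$ -/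

import Mathlib

noncomputable section

/-- The Fourier symbol of the (negative) discrete Laplacian on `ℤ^d`:
`ω(ξ) = 4 ∑_j sin² (ξ_j / 2)`. -/
def latticeSymbol {d : ℕ} (ξ : Fin d → ℝ) : ℝ :=
  4 * ∑ j, Real.sin (ξ j / 2) ^ 2

/-- The lattice fractional heat kernel on `ℤ^d`,
`G_t^{(s)}(x) = (2π)^{-d} ∫_{[-π,π]^d} exp (-t ω(ξ)^s) exp (i ⟨x, ξ⟩) dξ`,
written as the complex-valued Fourier integral, with Lebesgue measure on `[-π,π]^d`. -/
def latticeHeatKernel {d : ℕ} (s t : ℝ) (x : Fin d → ℤ) : ℂ :=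
  (1 / (2 * (Real.pi : ℂ)) ^ d) *
    ∫ ξ in Set.Icc (fun _ : Fin d => -Real.pi) (fun _ : Fin d => Real.pi),
      (Real.exp (-t * latticeSymbol ξ ^ s) : ℂ) *
        Complex.exp (Complex.I * ((∑ j, (x j : ℝ) * ξ j : ℝ) : ℂ))

/-- The Euclidean length `|y| = (y_1² + ⋯ + y_d²)^{1/2}` of a lattice point. -/
def latticeNorm {d : ℕ} (y : Fin d → ℤ) : ℝ :=
  Real.sqrt (∑ j, (y j : ℝ) ^ 2)

end

/-! The kernel is nonnegative, even and nonincreasing away from zero in each coordinate. Indeed `1 -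
ω/(4d)` is the symbol of a lazy random walk, whose step preserves this class. The series of `1 - (1
- z)^s` has nonnegative coefficients, so putting `z = 1 - ω/(4d)` shows that multiplication by `1 -
(ω/(4d))^s` preserves it too; exponentiating gives `exp (-t ω^s)` (`exp_neg_mul_rpow`).

For such a kernel a unit shift along `e_j` telescopes to twice the mass of the hyperplane `x_j = 0`
(`hasSum_abs_sub_single`). By Fourier inversion that mass is a one-dimensional integral of `exp (-t
ω(θ e_j)^s)`, of size at most a constant times `t^(-1/(2s))`. Subadditivity of the translation
distance extends the bound to all `y`; total mass one supplies the bound by 2. -/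

/-! ### Power series of `1 - (1 - z)^s` -/

theorem hasSum_one_sub_rpow_of_lt_one (s : ℝ) {z : ℝ} (hz₀ : 0 ≤ z) (hz₁ : z < 1) :
    HasSum (fun n => Ring.multichoose (-s) n * z ^ n) ((1 - z) ^ s) := by
  have h := Real.one_div_one_sub_rpow_hasFPowerSeriesOnBall_zero (-s)
  have hmem : z ∈ Metric.eball (0 : ℝ) 1 := by
    simp [Metric.mem_eball, edist_dist, abs_of_nonneg hz₀, hz₁]
  have := h.hasSum hmem
  simp only [zero_add, FormalMultilinearSeries.ofScalars_apply_eq, smul_eq_mul] at this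
  rw [Real.rpow_neg (by linarith), one_div, inv_inv] at this
  simpa only [Ring.multichoose_eq] using this

/-- The rising factorial `(-s)(1-s)(2-s)⋯` has one negative factor; the others are nonnegative
because `s ≤ 1`. -/
theorem multichoose_neg_nonpos {s : ℝ} (hs₀ : 0 < s) (hs₁ : s ≤ 1) (n : ℕ) :
    Ring.multichoose (-s) (n + 1) ≤ 0 := by
  have key : (ascPochhammer ℝ (n + 1)).eval (-s) ≤ 0 := by
    induction n with
    | zero => simp [hs₀.le]
    | succ n ih =>
      rw [ascPochhammer_succ_eval]
      refine mul_nonpos_of_nonpos_of_nonneg ih ?_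
      push_cast
      have : (0 : ℝ) ≤ n := n.cast_nonneg
      linarith
  have h := Ring.factorial_nsmul_multichoose_eq_ascPochhammer (-s) (n + 1)
  rw [Polynomial.ascPochhammer_smeval_eq_eval, nsmul_eq_mul] at h
  rw [← h] at key
  exact nonpos_of_mul_nonpos_right key (by positivity)

/-- The power series of `1 - (1 - z) ^ s` has nonnegative coefficients and converges on `[0, 1]`. -/
theorem exists_hasSum_one_sub_one_sub_rpow {s : ℝ} (hs₀ : 0 < s) (hs₁ : s ≤ 1) :
    ∃ a : ℕ → ℝ, (∀ n, 0 ≤ a n) ∧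
      ∀ z : ℝ, 0 ≤ z → z ≤ 1 → HasSum (fun n => a n * z ^ (n + 1)) (1 - (1 - z) ^ s) := by
  set a : ℕ → ℝ := fun n => -Ring.multichoose (-s) (n + 1) with ha
  have ha₀ : ∀ n, 0 ≤ a n := fun n => neg_nonneg.2 (multichoose_neg_nonpos hs₀ hs₁ n)
  have hlt : ∀ z : ℝ, 0 ≤ z → z < 1 → HasSum (fun n => a n * z ^ (n + 1)) (1 - (1 - z) ^ s) := by
    intro z hz₀ hz₁
    have h := hasSum_one_sub_rpow_of_lt_one s hz₀ hz₁
    rw [← hasSum_nat_add_iff' 1] at h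
    simpa [ha] using h.neg
  -- Letting `z → 1` from below bounds the partial sums of the coefficients. This gives the endpoint
  -- `z = 1`, which is needed because `ω` vanishes at the origin.
  have hpart : ∀ N, ∑ n ∈ Finset.range N, a n ≤ 1 := by
    intro N
    have hc : Filter.Tendsto (fun z : ℝ => ∑ n ∈ Finset.range N, a n * z ^ (n + 1))
        (nhdsWithin 1 (Set.Ico 0 1)) (nhds (∑ n ∈ Finset.range N, a n * 1 ^ (n + 1))) := by
      refine (Continuous.tendsto ?_ 1).mono_left nhdsWithin_le_nhds
      fun_prop
    have : (nhdsWithin (1 : ℝ) (Set.Ico 0 1)).NeBot := by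
      rw [← mem_closure_iff_nhdsWithin_neBot, closure_Ico zero_ne_one]
      simp
    simp only [one_pow, mul_one] at hc
    refine le_of_tendsto hc ?_
    filter_upwards [self_mem_nhdsWithin] with z hz
    have h := hlt z hz.1 hz.2
    refine (sum_le_hasSum _ (fun n _ => mul_nonneg (ha₀ n) (pow_nonneg hz.1 _)) h).trans ?_
    have := Real.rpow_nonneg (sub_nonneg.2 hz.2.le) s
    linarith
  have hsum : Summable a := summable_of_sum_range_le ha₀ hpart
  have hbound : ∀ n, ∀ z ∈ Set.Icc (0 : ℝ) 1, ‖a n * z ^ (n + 1)‖ ≤ a n := by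
    intro n z hz
    rw [Real.norm_of_nonneg (mul_nonneg (ha₀ n) (pow_nonneg hz.1 _))]
    exact mul_le_of_le_one_right (ha₀ n) (pow_le_one₀ hz.1 hz.2)
  have hcont : ContinuousOn (fun z : ℝ => ∑' n, a n * z ^ (n + 1)) (Set.Icc 0 1) :=
    continuousOn_tsum (fun n => by fun_prop) hsum hbound
  have hcont' : ContinuousOn (fun z : ℝ => 1 - (1 - z) ^ s) (Set.Icc 0 1) :=
    Continuous.continuousOn
      (continuous_const.sub ((continuous_const.sub continuous_id).rpow_const fun _ => .inr hs₀.le))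
  have heq : Set.EqOn (fun z : ℝ => ∑' n, a n * z ^ (n + 1)) (fun z => 1 - (1 - z) ^ s)
      (Set.Icc 0 1) := by
    have : Set.EqOn (fun z : ℝ => ∑' n, a n * z ^ (n + 1)) (fun z => 1 - (1 - z) ^ s)
        (Set.Ico 0 1) := fun z hz => (hlt z hz.1 hz.2).tsum_eq
    refine this.of_subset_closure hcont hcont' Set.Ico_subset_Icc_self ?_
    rw [closure_Ico zero_ne_one]
  refine ⟨a, ha₀, fun z hz₀ hz₁ => ?_⟩
  rw [show 1 - (1 - z) ^ s = _ from (heq ⟨hz₀, hz₁⟩).symm]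
  exact (Summable.of_norm_bounded hsum fun n => hbound n z ⟨hz₀, hz₁⟩).hasSum
-- Characters of `ℤ^d`
noncomputable section

variable {d : ℕ}

/-- The character `ξ ↦ exp (i ⟨x, ξ⟩)` attached to a lattice point. -/
def latticeChar (x : Fin d → ℤ) (ξ : Fin d → ℝ) : ℂ :=
  Complex.exp (Complex.I * ((∑ j, (x j : ℝ) * ξ j : ℝ) : ℂ))

theorem latticeChar_add (x y : Fin d → ℤ) (ξ : Fin d → ℝ) :
    latticeChar (x + y) ξ = latticeChar x ξ * latticeChar y ξ := by
  simp only [latticeChar, ← Complex.exp_add, ← mul_add, ← Complex.ofReal_add,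
    ← Finset.sum_add_distrib, ← add_mul, Pi.add_apply, Int.cast_add]

@[simp] theorem norm_latticeChar (x : Fin d → ℤ) (ξ : Fin d → ℝ) : ‖latticeChar x ξ‖ = 1 := by
  rw [latticeChar, mul_comm, Complex.norm_exp_ofReal_mul_I]

@[simp] theorem latticeChar_zero_left (ξ : Fin d → ℝ) : latticeChar (0 : Fin d → ℤ) ξ = 1 := by
  simp [latticeChar]

@[simp] theorem latticeChar_zero_right (x : Fin d → ℤ) : latticeChar x 0 = 1 := by
  simp [latticeChar]

theorem latticeChar_single (j : Fin d) (n : ℤ) (ξ : Fin d → ℝ) :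
    latticeChar (Pi.single j n) ξ = Complex.exp (((n * ξ j : ℝ) : ℂ) * Complex.I) := by
  rw [latticeChar, Finset.sum_eq_single j, Pi.single_eq_same, mul_comm]
  · intro i _ hi
    simp [Pi.single_eq_of_ne hi]
  · simp

theorem continuous_latticeChar (x : Fin d → ℤ) : Continuous (latticeChar x) := by
  unfold latticeChar
  fun_prop

/-! ### Symmetric unimodal functions -/

/-- Nonnegative functions on `ℤ^d` that are even and unimodal in each coordinate. -/
structure IsSymmUnimodal (g : (Fin d → ℤ) → ℝ) : Prop where
  nonneg : ∀ x, 0 ≤ g x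
  symm : ∀ j x, g (Function.update x j (-x j)) = g x
  anti : ∀ j x, 0 ≤ x j → g (x + Pi.single j 1) ≤ g x

namespace IsSymmUnimodal

theorem smul {g : (Fin d → ℤ) → ℝ} (hg : IsSymmUnimodal g) {c : ℝ} (hc : 0 ≤ c) :
    IsSymmUnimodal fun x => c * g x where
  nonneg x := mul_nonneg hc (hg.nonneg x)
  symm j x := by rw [hg.symm]
  anti j x hx := mul_le_mul_of_nonneg_left (hg.anti j x hx) hc

theorem tsum {ι : Type*} {g : ι → (Fin d → ℤ) → ℝ} (hg : ∀ i, IsSymmUnimodal (g i))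
    (hs : ∀ x, Summable fun i => g i x) : IsSymmUnimodal fun x => ∑' i, g i x where
  nonneg x := tsum_nonneg fun i => (hg i).nonneg x
  symm j x := tsum_congr fun i => (hg i).symm j x
  anti j x hx := (hs _).tsum_le_tsum (fun i => (hg i).anti j x hx) (hs _)

theorem single_zero : IsSymmUnimodal fun x : Fin d → ℤ => if x = 0 then (1 : ℝ) else 0 where
  nonneg x := by positivity
  symm j x := by
    have : Function.update x j (-x j) = 0 ↔ x = 0 := by
      constructor
      · intro h
        ext i
        have := congrFun h i
        by_cases hi : i = j
        · subst hi; simpa using this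
        · simpa [hi] using this
      · rintro rfl
        simp
    simp only [this]
  anti j x hx := by
    rw [if_neg]
    · positivity
    · intro h
      have := congrFun h j
      simp at this
      omega

theorem symm_anti {g : (Fin d → ℤ) → ℝ} (hg : IsSymmUnimodal g) (j : Fin d) (x : Fin d → ℤ)
    (hx : x j ≤ 0) : g (x - Pi.single j 1) ≤ g x := by
  have h := hg.anti j (Function.update x j (-x j)) (by simpa using hx)
  rw [hg.symm] at h
  rw [← hg.symm j (x - _)]
  convert h using 2
  ext i
  by_cases hi : i = j
  · subst hi; simp; ring
  · simp [hi]

/-- Averaging with the lazy nearest neighbour step in one coordinate. -/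
theorem lazyStep {g : (Fin d → ℤ) → ℝ} (hg : IsSymmUnimodal g) (j : Fin d) :
    IsSymmUnimodal fun x =>
      g x / 2 + (g (x + Pi.single j 1) + g (x - Pi.single j 1)) / 4 where
  nonneg x := by
    have := hg.nonneg x
    have := hg.nonneg (x + Pi.single j 1)
    have := hg.nonneg (x - Pi.single j 1)
    positivity
  symm i x := by
    by_cases hi : i = j
    · subst hi
      have h₁ : Function.update x i (-x i) + Pi.single i 1
          = Function.update (x - Pi.single i 1) i (-(x - (Pi.single i 1 : Fin d → ℤ)) i) := by
        ext k
        by_cases hk : k = i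
        · subst hk; simp; ring
        · simp [hk]
      have h₂ : Function.update x i (-x i) - Pi.single i 1
          = Function.update (x + Pi.single i 1) i (-(x + (Pi.single i 1 : Fin d → ℤ)) i) := by
        ext k
        by_cases hk : k = i
        · subst hk; simp; ring
        · simp [hk]
      rw [h₁, h₂, hg.symm, hg.symm, hg.symm]
      ring
    · have h₁ : Function.update x i (-x i) + Pi.single j 1
          = Function.update (x + Pi.single j 1) i (-(x + (Pi.single j 1 : Fin d → ℤ)) i) := by
        ext k
        by_cases hk : k = i
        · subst hk; simp [hi]
        · simp [hk]
      have h₂ : Function.update x i (-x i) - Pi.single j 1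
          = Function.update (x - Pi.single j 1) i (-(x - (Pi.single j 1 : Fin d → ℤ)) i) := by
        ext k
        by_cases hk : k = i
        · subst hk; simp [hi]
        · simp [hk]
      rw [h₁, h₂, hg.symm, hg.symm, hg.symm]
  anti i x hx := by
    by_cases hi : i = j
    · subst hi
      set e : Fin d → ℤ := Pi.single i 1 with he
      have hei : e i = 1 := by simp [he]
      have h₁ : g (x + e + e) ≤ g x :=
        (hg.anti i (x + e) (by simp [hei]; omega)).trans (hg.anti i x hx)
      -- The weight 1/2 on staying put reduces the claim to this and `h₁`; the non-lazy step already
      -- fails on a point mass. On `x i = 0` the two points are reflections of each other.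
      have h₂ : g (x + e) ≤ g (x - e) := by
        rcases hx.eq_or_lt with h0 | h0
        · rw [← hg.symm i (x - e)]
          refine le_of_eq (congrArg g ?_)
          ext k
          by_cases hk : k = i
          · subst hk; simp [hei, ← h0]
          · simp [hk, he]
        · refine (hg.anti i x hx).trans ?_
          have := hg.anti i (x - e) (by simp [hei]; omega)
          rwa [← he, sub_add_cancel] at this
      rw [add_sub_cancel_right]
      linarith
    · have hij : (Pi.single j 1 : Fin d → ℤ) i = 0 := by simp [hi]
      have h₁ := hg.anti i x hx
      have h₂ := hg.anti i (x + Pi.single j 1) (by simpa [hij] using hx)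
      have h₃ := hg.anti i (x - Pi.single j 1) (by simpa [hij] using hx)
      rw [add_right_comm] at h₂
      rw [sub_add_eq_add_sub] at h₃
      linarith

end IsSymmUnimodal

/-! ### Symbols of unimodal functions -/

/-- `f` is the Fourier transform of a summable, even and coordinatewise unimodal function `g`. -/
structure IsFourierPair (g : (Fin d → ℤ) → ℝ) (f : (Fin d → ℝ) → ℝ) : Prop where
  unimodal : IsSymmUnimodal g
  summable : Summable g
  hasSum : ∀ ξ, HasSum (fun x => (g x : ℂ) * latticeChar (-x) ξ) (f ξ : ℂ)

/-- `f` is the Fourier transform of some summable, even and coordinatewise unimodal function. -/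
def IsUnimodalSymbol (f : (Fin d → ℝ) → ℝ) : Prop := ∃ g, IsFourierPair g f

theorem IsFourierPair.hasSum_zero {g : (Fin d → ℤ) → ℝ} {f : (Fin d → ℝ) → ℝ}
    (h : IsFourierPair g f) : HasSum g (f 0) := by
  have := h.hasSum 0
  simp only [latticeChar_zero_right, mul_one] at this
  exact Complex.hasSum_ofReal.1 this

namespace IsUnimodalSymbol

theorem one : IsUnimodalSymbol fun _ : Fin d → ℝ => 1 := by
  refine ⟨_, IsSymmUnimodal.single_zero, (hasSum_ite_eq 0 1).summable, fun ξ => ?_⟩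
  convert hasSum_ite_eq (0 : Fin d → ℤ) (1 : ℂ) using 2 with x
  · split_ifs with h
    · simp [h]
    · simp
  · simp

theorem const_mul {f : (Fin d → ℝ) → ℝ} (hf : IsUnimodalSymbol f) {c : ℝ} (hc : 0 ≤ c) :
    IsUnimodalSymbol fun ξ => c * f ξ := by
  obtain ⟨g, hg⟩ := hf
  refine ⟨_, hg.unimodal.smul hc, hg.summable.mul_left c, fun ξ => ?_⟩
  simpa [mul_assoc] using (hg.hasSum ξ).mul_left (c : ℂ)

/-- By nonnegativity, convergence at `ξ = 0` alone says that the total masses are summable. The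
double series is then absolutely convergent at every `ξ`, and the sums may be exchanged. -/
theorem of_hasSum {ι : Type*} {F : ι → (Fin d → ℝ) → ℝ} {f : (Fin d → ℝ) → ℝ}
    (hF : ∀ i, IsUnimodalSymbol (F i)) (hf : ∀ ξ, HasSum (fun i => F i ξ) (f ξ)) :
    IsUnimodalSymbol f := by
  choose g hg using hF
  have hprod : Summable fun p : ι × (Fin d → ℤ) => g p.1 p.2 := by
    refine (summable_prod_of_nonneg fun p => (hg p.1).unimodal.nonneg p.2).2
      ⟨fun i => (hg i).summable, ?_⟩
    simpa only [fun i => (hg i).hasSum_zero.tsum_eq] using (hf 0).summable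
  have hswap := hprod.prod_symm
  refine ⟨fun x => ∑' i, g i x, .tsum (fun i => (hg i).unimodal) fun x => hswap.prod_factor x,
    hswap.prod, fun ξ => ?_⟩
  have hchar : Summable fun p : (Fin d → ℤ) × ι => (g p.2 p.1 : ℂ) * latticeChar (-p.1) ξ := by
    refine Summable.of_norm_bounded hswap fun p => ?_
    simp [abs_of_nonneg ((hg p.2).unimodal.nonneg p.1)]
  have h₁ := hchar.hasSum.prod_fiberwise fun x => (hchar.prod_factor x).hasSum
  have h₂ := hchar.prod_symm.hasSum.prod_fiberwise fun i => (hg i).hasSum ξ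
  have h₃ : HasSum (fun i => (F i ξ : ℂ)) (f ξ : ℂ) := Complex.hasSum_ofReal.2 (hf ξ)
  have h₄ : ∑' p : (Fin d → ℤ) × ι, (g p.2 p.1 : ℂ) * latticeChar (-p.1) ξ = f ξ := by
    rw [h₃.unique h₂]
    exact ((Equiv.prodComm ι (Fin d → ℤ)).tsum_eq
      fun p : (Fin d → ℤ) × ι => (g p.2 p.1 : ℂ) * latticeChar (-p.1) ξ).symm
  rw [h₄] at h₁
  convert h₁ using 2 with x
  simp only [tsum_mul_right, Complex.ofReal_tsum]

theorem mul_lazyStep {f : (Fin d → ℝ) → ℝ} (hf : IsUnimodalSymbol f) (j : Fin d) :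
    IsUnimodalSymbol fun ξ => (1 + Real.cos (ξ j)) / 2 * f ξ := by
  obtain ⟨g, hg⟩ := hf
  set e : Fin d → ℤ := Pi.single j 1 with he
  have s₁ : Summable fun x => g (x + e) := (Equiv.addRight e).summable_iff.2 hg.summable
  have s₂ : Summable fun x => g (x - e) := (Equiv.subRight e).summable_iff.2 hg.summable
  refine ⟨_, hg.unimodal.lazyStep j, (hg.summable.div_const 2).add ((s₁.add s₂).div_const 4),
    fun ξ => ?_⟩
  have h₀ := hg.hasSum ξ
  have h₁ := ((Equiv.addRight e).hasSum_iff.2 h₀).mul_left (latticeChar e ξ)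
  have h₂ := ((Equiv.subRight e).hasSum_iff.2 h₀).mul_left (latticeChar (-e) ξ)
  have h := (h₀.div_const 2).add ((h₁.add h₂).div_const 4)
  convert! h using 2 with x
  · have c₁ : latticeChar (-x) ξ = latticeChar e ξ * latticeChar (-(x + e)) ξ := by
      rw [← latticeChar_add]; congr 1; abel
    have c₂ : latticeChar (-x) ξ = latticeChar (-e) ξ * latticeChar (-(x - e)) ξ := by
      rw [← latticeChar_add]; congr 1; abel
    simp only [Function.comp_apply, Equiv.coe_addRight, Equiv.subRight_apply, ← he]
    rw [mul_left_comm (latticeChar e ξ), ← c₁, mul_left_comm (latticeChar (-e) ξ), ← c₂]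
    push_cast
    ring
  · have hc : latticeChar e ξ + latticeChar (-e) ξ = 2 * Complex.cos (ξ j) := by
      rw [Complex.two_cos, he, ← Pi.single_neg, latticeChar_single, latticeChar_single]
      push_cast
      ring_nf
    rw [← add_mul, hc]
    push_cast
    ring

end IsUnimodalSymbol

/-! ### The symbol `ω` and its fractional exponential -/

open MeasureTheory

theorem latticeSymbol_eq (ξ : Fin d → ℝ) :
    latticeSymbol ξ = ∑ j, 2 * (1 - Real.cos (ξ j)) := by
  rw [latticeSymbol, Finset.mul_sum]
  refine Finset.sum_congr rfl fun j _ => ?_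
  rw [Real.sin_sq_eq_half_sub, mul_div_cancel₀ _ two_ne_zero]
  ring

theorem latticeSymbol_nonneg (ξ : Fin d → ℝ) : 0 ≤ latticeSymbol ξ := by
  unfold latticeSymbol
  positivity

theorem latticeSymbol_le (ξ : Fin d → ℝ) : latticeSymbol ξ ≤ 4 * d := by
  unfold latticeSymbol
  refine mul_le_mul_of_nonneg_left ?_ (by norm_num)
  refine (Finset.sum_le_card_nsmul _ _ 1 fun j _ => Real.sin_sq_le_one _).trans ?_
  simp

theorem continuous_latticeSymbol : Continuous (latticeSymbol : (Fin d → ℝ) → ℝ) := by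
  unfold latticeSymbol
  fun_prop

namespace IsUnimodalSymbol

/-- Multiplication by the symbol of the lazy simple random walk. -/
theorem mul_one_sub_latticeSymbol (hd : 1 ≤ d) {f : (Fin d → ℝ) → ℝ} (hf : IsUnimodalSymbol f) :
    IsUnimodalSymbol fun ξ => (1 - latticeSymbol ξ / (4 * d)) * f ξ := by
  have hd' : (d : ℝ) ≠ 0 := by positivity
  refine of_hasSum (fun j : Fin d => (hf.mul_lazyStep j).const_mul (c := 1 / d) (by positivity))
    fun ξ => ?_
  convert hasSum_fintype fun j : Fin d => 1 / (d : ℝ) * ((1 + Real.cos (ξ j)) / 2 * f ξ) using 1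
  rw [← Finset.mul_sum, ← Finset.sum_mul, ← Finset.sum_div, latticeSymbol_eq, ← Finset.mul_sum,
    Finset.sum_add_distrib, Finset.sum_sub_distrib]
  simp only [Finset.sum_const, Finset.card_univ, Fintype.card_fin, nsmul_eq_mul, mul_one]
  field_simp
  ring

theorem mul_pow_one_sub_latticeSymbol (hd : 1 ≤ d) {f : (Fin d → ℝ) → ℝ}
    (hf : IsUnimodalSymbol f) (n : ℕ) :
    IsUnimodalSymbol fun ξ => (1 - latticeSymbol ξ / (4 * d)) ^ n * f ξ := by
  induction n with
  | zero => simpa using hf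
  | succ n ih => simpa [pow_succ', mul_assoc] using ih.mul_one_sub_latticeSymbol hd

theorem mul_one_sub_rpow (hd : 1 ≤ d) {s : ℝ} (hs₀ : 0 < s) (hs₁ : s ≤ 1)
    {f : (Fin d → ℝ) → ℝ} (hf : IsUnimodalSymbol f) :
    IsUnimodalSymbol fun ξ => (1 - (latticeSymbol ξ / (4 * d)) ^ s) * f ξ := by
  obtain ⟨a, ha, h⟩ := exists_hasSum_one_sub_one_sub_rpow hs₀ hs₁
  refine of_hasSum
    (fun n => (hf.mul_pow_one_sub_latticeSymbol hd (n + 1)).const_mul (ha n)) fun ξ => ?_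
  have hd' : (0 : ℝ) < d := by positivity
  have h₀ : 0 ≤ latticeSymbol ξ / (4 * d) := div_nonneg (latticeSymbol_nonneg ξ) (by positivity)
  have h₁ : latticeSymbol ξ / (4 * d) ≤ 1 := (div_le_one (by positivity)).2 (latticeSymbol_le ξ)
  have := (h (1 - latticeSymbol ξ / (4 * d)) (by linarith) (by linarith)).mul_right (f ξ)
  simpa only [sub_sub_cancel, mul_assoc] using this

theorem pow_one_sub_rpow (hd : 1 ≤ d) {s : ℝ} (hs₀ : 0 < s) (hs₁ : s ≤ 1) (n : ℕ) :
    IsUnimodalSymbol fun ξ : Fin d → ℝ => (1 - (latticeSymbol ξ / (4 * d)) ^ s) ^ n := by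
  induction n with
  | zero => simpa using one
  | succ n ih => simpa [pow_succ'] using ih.mul_one_sub_rpow hd hs₀ hs₁

/-- Poissonization: with `T = t (4d)^s` one has `-t ω^s = -T + T (1 - (ω/(4d))^s)`, and the
exponential series in the last term has nonnegative coefficients. -/
theorem exp_neg_mul_rpow (hd : 1 ≤ d) {s t : ℝ} (hs₀ : 0 < s) (hs₁ : s ≤ 1) (ht : 0 < t) :
    IsUnimodalSymbol fun ξ : Fin d → ℝ => Real.exp (-t * latticeSymbol ξ ^ s) := by
  have hd' : (0 : ℝ) < d := by positivity
  set T : ℝ := t * (4 * d) ^ s with hT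
  have hT₀ : 0 ≤ T := by positivity
  have hexp : IsUnimodalSymbol fun ξ : Fin d → ℝ =>
      Real.exp (T * (1 - (latticeSymbol ξ / (4 * d)) ^ s)) := by
    refine of_hasSum (fun n : ℕ => (pow_one_sub_rpow hd hs₀ hs₁ n).const_mul
      (c := T ^ n / n.factorial) (by positivity)) fun ξ => ?_
    have := NormedSpace.expSeries_div_hasSum_exp (T * (1 - (latticeSymbol ξ / (4 * d)) ^ s))
    rw [← Real.exp_eq_exp_ℝ] at this
    simpa only [mul_pow, mul_div_right_comm] using this
  convert hexp.const_mul (Real.exp_nonneg (-T)) using 2 with ξ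
  rw [← Real.exp_add, Real.div_rpow (latticeSymbol_nonneg ξ) (by positivity), hT]
  congr 1
  field_simp
  ring

end IsUnimodalSymbol

/-! ### Fourier inversion -/

theorem setIntegral_exp_int_mul_I (n : ℤ) :
    ∫ θ in Set.Icc (-Real.pi) Real.pi, Complex.exp (((n * θ : ℝ) : ℂ) * Complex.I) =
      if n = 0 then 2 * (Real.pi : ℂ) else 0 := by
  rw [integral_Icc_eq_integral_Ioc, ← intervalIntegral.integral_of_le (by linarith [Real.pi_pos])]
  split_ifs with hn
  · subst hn
    simp
    ring
  · have hc : (n : ℂ) * Complex.I ≠ 0 := mul_ne_zero (by exact_mod_cast hn) Complex.I_ne_zero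
    have := integral_exp_mul_complex (a := -Real.pi) (b := Real.pi) hc
    have hrw : ∀ θ : ℝ, ((n * θ : ℝ) : ℂ) * Complex.I = n * Complex.I * θ := fun θ => by
      push_cast; ring
    simp only [hrw, this]
    rw [div_eq_zero_iff, sub_eq_zero]
    left
    rw [Complex.exp_eq_exp_iff_exists_int]
    exact ⟨n, by push_cast; ring⟩

theorem latticeChar_eq_prod (x : Fin d → ℤ) (ξ : Fin d → ℝ) :
    latticeChar x ξ = ∏ j, Complex.exp (((x j * ξ j : ℝ) : ℂ) * Complex.I) := by
  rw [latticeChar, ← Complex.exp_sum, ← Finset.sum_mul, mul_comm, Complex.ofReal_sum]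

theorem setIntegral_latticeChar (x : Fin d → ℤ) :
    ∫ ξ in Set.Icc (fun _ : Fin d => -Real.pi) (fun _ : Fin d => Real.pi), latticeChar x ξ =
      if x = 0 then (2 * (Real.pi : ℂ)) ^ d else 0 := by
  rw [← Set.pi_univ_Icc, volume_pi, Measure.restrict_pi_pi]
  simp only [latticeChar_eq_prod]
  rw [integral_fintype_prod_eq_prod
    (fun j (θ : ℝ) => Complex.exp (((x j * θ : ℝ) : ℂ) * Complex.I))]
  simp only [setIntegral_exp_int_mul_I]
  split_ifs with hx
  · simp [hx]
  · obtain ⟨j, hj⟩ := Function.ne_iff.1 hx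
    exact Finset.prod_eq_zero (Finset.mem_univ j) (if_neg hj)

namespace IsFourierPair

variable {g : (Fin d → ℤ) → ℝ} {f : (Fin d → ℝ) → ℝ}

/-- The measure is left general to cover both Lebesgue measure on the cube, which recovers `g`, and
its one-dimensional analogue on a coordinate axis, which recovers hyperplane masses. -/
theorem hasSum_integral (h : IsFourierPair g f) (μ : Measure (Fin d → ℝ)) [IsFiniteMeasure μ]
    (x : Fin d → ℤ) :
    HasSum (fun y => (g y : ℂ) * ∫ ξ, latticeChar (x - y) ξ ∂μ)
      (∫ ξ, (f ξ : ℂ) * latticeChar x ξ ∂μ) := by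
  have hint : ∀ y, Integrable (fun ξ => (g y : ℂ) * latticeChar (x - y) ξ) μ := fun y =>
    Integrable.of_bound
      (continuous_const.mul (continuous_latticeChar _)).aestronglyMeasurable (g y)
      (.of_forall fun ξ => by simp [abs_of_nonneg (h.unimodal.nonneg y)])
  have hsum : Summable fun y => ∫ ξ, ‖(g y : ℂ) * latticeChar (x - y) ξ‖ ∂μ := by
    simpa using (h.summable.abs.mul_left (μ.real Set.univ))
  have := hasSum_integral_of_summable_integral_norm hint hsum
  simp only [integral_const_mul] at this
  convert! this using 3 with ξ
  rw [← ((h.hasSum ξ).mul_right (latticeChar x ξ)).tsum_eq]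
  refine tsum_congr fun y => ?_
  rw [mul_assoc, ← latticeChar_add, neg_add_eq_sub]

theorem setIntegral_eq (h : IsFourierPair g f) (x : Fin d → ℤ) :
    1 / (2 * (Real.pi : ℂ)) ^ d *
      ∫ ξ in Set.Icc (fun _ : Fin d => -Real.pi) (fun _ : Fin d => Real.pi),
        (f ξ : ℂ) * latticeChar x ξ = g x := by
  have : IsFiniteMeasure (volume.restrict
      (Set.Icc (fun _ : Fin d => -Real.pi) (fun _ : Fin d => Real.pi))) :=
    isFiniteMeasure_restrict.2 isCompact_Icc.measure_lt_top.ne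
  have hs := h.hasSum_integral (volume.restrict
    (Set.Icc (fun _ : Fin d => -Real.pi) (fun _ : Fin d => Real.pi))) x
  simp only [setIntegral_latticeChar] at hs
  rw [hs.unique (hasSum_single x fun y hy => by rw [if_neg (sub_ne_zero.2 hy.symm), mul_zero])]
  have hpi : (2 * (Real.pi : ℂ)) ^ d ≠ 0 := by
    exact pow_ne_zero _ (mul_ne_zero two_ne_zero (Complex.ofReal_ne_zero.2 Real.pi_ne_zero))
  rw [sub_self, if_pos rfl]
  field_simp

/-- The mass of the hyperplane `x j = 0` is a one-dimensional Fourier integral. -/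
theorem hasSum_hyperplane (h : IsFourierPair g f) (hf : Continuous f) (j : Fin d) :
    HasSum (fun x => if x j = 0 then g x else 0)
      (1 / (2 * Real.pi) * ∫ θ in Set.Icc (-Real.pi) Real.pi, f (Pi.single j θ)) := by
  have hc : Continuous fun θ : ℝ => (Pi.single j θ : Fin d → ℝ) := continuous_const.update j continuous_id
  have : IsFiniteMeasure (volume.restrict (Set.Icc (-Real.pi) Real.pi)) :=
    isFiniteMeasure_restrict.2 isCompact_Icc.measure_lt_top.ne
  have hs := h.hasSum_integral
    ((volume.restrict (Set.Icc (-Real.pi) Real.pi)).map fun θ : ℝ => Pi.single j θ) 0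
  have hchar : ∀ y : Fin d → ℤ, ∀ θ : ℝ, latticeChar (0 - y) (Pi.single j θ) =
      Complex.exp ((((-y j : ℤ) * θ : ℝ) : ℂ) * Complex.I) := fun y θ => by
    rw [latticeChar, Finset.sum_eq_single j, Pi.single_eq_same, mul_comm, zero_sub, Pi.neg_apply]
    · intro i _ hi
      simp [Pi.single_eq_of_ne hi]
    · simp
  simp only [latticeChar_zero_left, mul_one] at hs
  have hf' : Continuous fun ξ => (f ξ : ℂ) := Complex.continuous_ofReal.comp hf
  rw [integral_map hc.aemeasurable hf'.aestronglyMeasurable] at hs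
  simp only [integral_map hc.aemeasurable (continuous_latticeChar _).aestronglyMeasurable, hchar,
    setIntegral_exp_int_mul_I, neg_eq_zero] at hs
  have hs' := hs.mul_left ((1 / (2 * Real.pi) : ℝ) : ℂ)
  rw [integral_complex_ofReal, ← Complex.ofReal_mul] at hs'
  rw [← Complex.hasSum_ofReal]
  convert! hs' using 2 with x
  split_ifs
  · have := Real.pi_ne_zero
    push_cast
    field_simp
  · simp

end IsFourierPair

/-! ### Translation distance -/

/-- For a symmetric unimodal function the unit shift costs twice the mass of the central
hyperplane. -/
theorem IsSymmUnimodal.hasSum_abs_sub_single {g : (Fin d → ℤ) → ℝ} (hg : IsSymmUnimodal g)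
    (hs : Summable g) (j : Fin d) {M : ℝ} (hM : HasSum (fun x => if x j = 0 then g x else 0) M) :
    HasSum (fun x => |g (x - Pi.single j 1) - g x|) (2 * M) := by
  set e : Fin d → ℤ := Pi.single j 1 with he
  have hej : e j = 1 := by simp [he]
  have ind : ∀ p : ℤ → Prop, ∀ [DecidablePred p], Summable fun x => if p (x j) then g x else 0 := by
    intro p _
    refine Summable.of_nonneg_of_le (fun x => ?_) (fun x => ?_) hs
    · split_ifs
      exacts [hg.nonneg x, le_rfl]
    · split_ifs
      exacts [le_rfl, hg.nonneg x]
  have hP := ind fun n => 0 ≤ n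
  have hS := ind fun n => n ≤ -1
  have h₁ := hP.hasSum.sub hM
  have h₂ := hS.hasSum.add hM
  -- Where `x j ≥ 1` the increments sum to the mass of `x j ≥ 0` minus that of `x j ≥ 1`; where `x j
  -- ≤ 0`, to the mass of `x j ≤ 0` minus that of `x j ≤ -1`. Each difference is `M`.
  have h := (((Equiv.subRight e).hasSum_iff.2 hP.hasSum).sub h₁).add
    (h₂.sub ((Equiv.subRight e).hasSum_iff.2 hS.hasSum))
  convert! h using 1
  · ext x
    simp only [Function.comp_apply, Equiv.subRight_apply, Pi.sub_apply, hej]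
    rcases lt_trichotomy (x j) 0 with hx | hx | hx
    · have := hg.symm_anti j x hx.le
      rw [← he] at this
      rw [abs_of_nonpos (by linarith)]
      split_ifs <;> first | omega | ring
    · have := hg.symm_anti j x hx.le
      rw [← he] at this
      rw [abs_of_nonpos (by linarith)]
      split_ifs <;> first | omega | ring
    · have := hg.anti j (x - e) (by simp [hej]; omega)
      rw [← he, sub_add_cancel] at this
      rw [abs_of_nonneg (by linarith)]
      split_ifs <;> first | omega | ring
  · ring

/-- The `ℓ¹` distance between a function and its translate. -/
def translationDist (g : (Fin d → ℤ) → ℝ) (y : Fin d → ℤ) : ℝ := ∑' x, |g (x - y) - g x|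

section translationDist

variable {g : (Fin d → ℤ) → ℝ}

theorem Summable.comp_sub_lattice (hg : Summable g) (y : Fin d → ℤ) :
    Summable fun x => g (x - y) := (Equiv.subRight y).summable_iff.2 hg

theorem summable_translationDist (hg : Summable g) (y : Fin d → ℤ) :
    Summable fun x => |g (x - y) - g x| := ((hg.comp_sub_lattice y).sub hg).abs

theorem translationDist_le (hg : Summable g) (y : Fin d → ℤ) :
    translationDist g y ≤ 2 * ∑' x, |g x| := by
  have h := hg.abs.comp_sub_lattice y
  have htr : ∑' x, |g (x - y)| = ∑' x, |g x| := (Equiv.subRight y).tsum_eq fun x => |g x|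
  calc translationDist g y ≤ ∑' x, (|g (x - y)| + |g x|) :=
        (summable_translationDist hg y).tsum_le_tsum (fun x => abs_sub _ _) (h.add hg.abs)
    _ = 2 * ∑' x, |g x| := by rw [h.tsum_add hg.abs, htr, two_mul]

theorem translationDist_zero : translationDist g 0 = 0 := by simp [translationDist]

theorem translationDist_add_le (hg : Summable g) (y z : Fin d → ℤ) :
    translationDist g (y + z) ≤ translationDist g y + translationDist g z := by
  have hy := (summable_translationDist hg y).comp_sub_lattice z
  have hz := summable_translationDist hg z
  have htr : ∑' x, |g (x - z - y) - g (x - z)| = translationDist g y :=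
    (Equiv.subRight z).tsum_eq fun x => |g (x - y) - g x|
  calc translationDist g (y + z)
      ≤ ∑' x, (|g (x - z - y) - g (x - z)| + |g (x - z) - g x|) := by
        refine (summable_translationDist hg _).tsum_le_tsum (fun x => ?_) (hy.add hz)
        rw [sub_sub, add_comm z y]
        exact abs_sub_le _ _ _
    _ = translationDist g y + translationDist g z := by
        rw [hy.tsum_add hz, htr]
        rfl

theorem translationDist_neg (y : Fin d → ℤ) : translationDist g (-y) = translationDist g y := by
  rw [translationDist, ← (Equiv.subRight y).tsum_eq, translationDist]
  refine tsum_congr fun x => ?_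
  simp [abs_sub_comm]

theorem translationDist_nsmul_le (hg : Summable g) (n : ℕ) (y : Fin d → ℤ) :
    translationDist g (n • y) ≤ n * translationDist g y := by
  induction n with
  | zero => simp [translationDist_zero]
  | succ n ih =>
    rw [succ_nsmul]
    refine (translationDist_add_le hg _ _).trans ?_
    push_cast
    linarith

theorem translationDist_zsmul_le (hg : Summable g) (n : ℤ) (y : Fin d → ℤ) :
    translationDist g (n • y) ≤ |(n : ℝ)| * translationDist g y := by
  obtain ⟨m, rfl | rfl⟩ := n.eq_nat_or_neg
  · simpa using translationDist_nsmul_le hg m y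
  · simpa [translationDist_neg] using translationDist_nsmul_le hg m y

/-- Move from `0` to `y` by unit steps along the axes and use subadditivity. -/
theorem translationDist_le_sum (hg : Summable g) (y : Fin d → ℤ) :
    translationDist g y ≤ ∑ j, |(y j : ℝ)| * translationDist g (Pi.single j 1) := by
  have hy : y = ∑ j, y j • (Pi.single j 1 : Fin d → ℤ) := by
    ext i
    simp [Finset.sum_apply, Pi.single_apply]
  conv_lhs => rw [hy]
  exact (Finset.le_sum_of_subadditive _ translationDist_zero.le (translationDist_add_le hg) _ _).trans
    (Finset.sum_le_sum fun j _ => translationDist_zsmul_le hg _ _)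

end translationDist

/-! ### Decay of the axis integral and conclusion -/

theorem abs_le_latticeNorm (y : Fin d → ℤ) (j : Fin d) : |(y j : ℝ)| ≤ latticeNorm y := by
  rw [latticeNorm, ← Real.sqrt_sq_eq_abs]
  exact Real.sqrt_le_sqrt
    (Finset.single_le_sum (f := fun j => (y j : ℝ) ^ 2) (fun i _ => sq_nonneg _)
      (Finset.mem_univ j))

/-- Jordan's inequality `sin u ≥ 2u/π` on `[0, π/2]`, taken at `u = |θ|/2`. -/
theorem rpow_le_latticeSymbol_single {s : ℝ} (hs : 0 < s) (j : Fin d) {θ : ℝ}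
    (hθ : |θ| ≤ Real.pi) :
    (2 / Real.pi) ^ (2 * s) * |θ| ^ (2 * s) ≤ latticeSymbol (Pi.single j θ : Fin d → ℝ) ^ s := by
  have hpi := Real.pi_pos
  have hsymb : latticeSymbol (Pi.single j θ : Fin d → ℝ) = (2 * Real.sin (|θ| / 2)) ^ 2 := by
    rw [latticeSymbol, Finset.sum_eq_single j, Pi.single_eq_same, mul_pow,
      Real.sin_sq_eq_half_sub, Real.sin_sq_eq_half_sub, mul_div_cancel₀ _ two_ne_zero,
      mul_div_cancel₀ _ two_ne_zero, Real.cos_abs]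
    · norm_num
    · intro i _ hi
      simp [Pi.single_eq_of_ne hi]
    · simp
  have h := Real.mul_le_sin (x := |θ| / 2) (by positivity) (by linarith)
  rw [hsymb, ← Real.mul_rpow (by positivity) (by positivity), Real.rpow_mul (by positivity),
    Real.rpow_two]
  refine Real.rpow_le_rpow (by positivity) (pow_le_pow_left₀ (by positivity) ?_ 2) hs.le
  linarith

theorem setIntegral_exp_neg_latticeSymbol_single_le {s t : ℝ} (hs : 0 < s) (ht : 0 < t)
    (j : Fin d) :
    ∫ θ in Set.Icc (-Real.pi) Real.pi,
        Real.exp (-t * latticeSymbol (Pi.single j θ : Fin d → ℝ) ^ s) ≤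
      2 * (((2 / Real.pi) ^ (2 * s)) ^ (-1 / (2 * s)) * Real.Gamma (1 / (2 * s) + 1)) *
        t ^ (-1 / (2 * s)) := by
  have hpi := Real.pi_pos
  set b : ℝ := t * (2 / Real.pi) ^ (2 * s) with hb
  have hb₀ : 0 < b := by positivity
  have hval : ∫ θ : ℝ, Real.exp (-b * |θ| ^ (2 * s)) =
      2 * (b ^ (-1 / (2 * s)) * Real.Gamma (1 / (2 * s) + 1)) := by
    rw [integral_comp_abs (f := fun θ => Real.exp (-b * θ ^ (2 * s))),
      integral_exp_neg_mul_rpow (by positivity) hb₀]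
  have hint : Integrable fun θ : ℝ => Real.exp (-b * |θ| ^ (2 * s)) := by
    -- A non-integrable function has integral `0` by convention, so the positive value `hval` proves
    -- integrability.
    refine Integrable.of_integral_ne_zero ?_
    rw [hval]
    have := Real.Gamma_pos_of_pos (s := 1 / (2 * s) + 1) (by positivity)
    positivity
  have hcont : Continuous fun θ : ℝ =>
      Real.exp (-t * latticeSymbol (Pi.single j θ : Fin d → ℝ) ^ s) := by
    have hc : Continuous fun θ : ℝ => (Pi.single j θ : Fin d → ℝ) :=
      continuous_const.update j continuous_id
    exact Real.continuous_exp.comp (continuous_const.mul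
      ((continuous_latticeSymbol.comp hc).rpow_const fun _ => .inr hs.le))
  calc _ ≤ ∫ θ in Set.Icc (-Real.pi) Real.pi, Real.exp (-b * |θ| ^ (2 * s)) := by
        refine setIntegral_mono_on hcont.continuousOn.integrableOn_Icc hint.integrableOn
          measurableSet_Icc fun θ hθ => Real.exp_le_exp.2 ?_
        have := mul_le_mul_of_nonneg_left
          (rpow_le_latticeSymbol_single hs j (abs_le.2 hθ)) ht.le
        rw [hb]
        linarith
    _ ≤ ∫ θ : ℝ, Real.exp (-b * |θ| ^ (2 * s)) :=
        setIntegral_le_integral hint (.of_forall fun θ => (Real.exp_pos _).le)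
    _ = _ := by
        rw [hval, hb, Real.mul_rpow ht.le (by positivity)]
        ring
end

theorem proposition1p2 (d : ℕ) (hd : 1 ≤ d) (s : ℝ) (hs₀ : 0 < s) (hs₁ : s ≤ 1) :
    ∃ C : ℝ, 0 < C ∧ ∀ t : ℝ, 0 < t → ∀ y : Fin d → ℤ,
      Summable (fun x : Fin d → ℤ =>
        ‖latticeHeatKernel s t (x - y) - latticeHeatKernel s t x‖) ∧
      ∑' x : Fin d → ℤ, ‖latticeHeatKernel s t (x - y) - latticeHeatKernel s t x‖ ≤
        C * min 1 (latticeNorm y * t ^ (-1 / (2 * s))) := by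
  -- The outer 2 counts the two half-spaces, `1/(2π)` is the Fourier normalization, and the rest is
  -- the Gamma integral bounding the axis integral.
  set K : ℝ := 2 * (1 / (2 * Real.pi) * (2 *
    (((2 / Real.pi) ^ (2 * s)) ^ (-1 / (2 * s)) * Real.Gamma (1 / (2 * s) + 1)))) with hK
  have hK₀ : 0 ≤ K := by
    have := Real.pi_pos
    have := Real.Gamma_pos_of_pos (s := 1 / (2 * s) + 1) (by positivity)
    positivity
  refine ⟨max 2 (d * K), by positivity, fun t ht y => ?_⟩
  obtain ⟨g, hg⟩ := IsUnimodalSymbol.exp_neg_mul_rpow hd hs₀ hs₁ ht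
  have hker : ∀ x, latticeHeatKernel s t x = g x := hg.setIntegral_eq
  have hnorm : ∀ x, ‖latticeHeatKernel s t (x - y) - latticeHeatKernel s t x‖ =
      |g (x - y) - g x| := fun x => by
    rw [hker, hker, ← Complex.ofReal_sub, Complex.norm_real, Real.norm_eq_abs]
  simp only [hnorm]
  refine ⟨summable_translationDist hg.summable y, ?_⟩
  change translationDist g y ≤ _
  -- The total mass is the symbol at `ξ = 0`, where `0^s = 0` since `s > 0`.
  have hmass : ∑' x, |g x| = 1 := by
    simp only [fun x => abs_of_nonneg (hg.unimodal.nonneg x)]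
    rw [hg.hasSum_zero.tsum_eq]
    simp [latticeSymbol, Real.zero_rpow hs₀.ne']
  have h₁ : translationDist g y ≤ 2 := by
    simpa [hmass] using translationDist_le hg.summable y
  have hcont : Continuous fun ξ : Fin d → ℝ => Real.exp (-t * latticeSymbol ξ ^ s) :=
    Real.continuous_exp.comp (continuous_const.mul
      (continuous_latticeSymbol.rpow_const fun _ => .inr hs₀.le))
  have hunit : ∀ j, translationDist g (Pi.single j 1) ≤ K * t ^ (-1 / (2 * s)) := fun j => by
    rw [translationDist,
      (hg.unimodal.hasSum_abs_sub_single hg.summable j (hg.hasSum_hyperplane hcont j)).tsum_eq,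
      hK, mul_assoc, mul_assoc]
    have := setIntegral_exp_neg_latticeSymbol_single_le hs₀ ht j
    gcongr
  have h₂ : translationDist g y ≤ d * K * (latticeNorm y * t ^ (-1 / (2 * s))) := by
    refine (translationDist_le_sum hg.summable y).trans ?_
    refine (Finset.sum_le_card_nsmul _ _ (latticeNorm y * (K * t ^ (-1 / (2 * s)))) fun j _ =>
      mul_le_mul (abs_le_latticeNorm y j) (hunit j) (tsum_nonneg fun _ => abs_nonneg _)
        (Real.sqrt_nonneg _)).trans_eq ?_
    rw [Finset.card_univ, Fintype.card_fin, nsmul_eq_mul]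
    ring
  have hnn : 0 ≤ latticeNorm y * t ^ (-1 / (2 * s)) :=
    mul_nonneg (Real.sqrt_nonneg _) (Real.rpow_nonneg ht.le _)
  rw [mul_min_of_nonneg _ _ (by positivity), mul_one]
  exact le_min (h₁.trans (le_max_left _ _))
    (h₂.trans (mul_le_mul_of_nonneg_right (le_max_right _ _) hnn))
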